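/- For positive semi-definite complex matrices $P,Q$ of the same (finite) size with $\ker Q\subseteq\ker P$, let $H(P,Q)=\operatorname{Tr}P(\log P-\log Q)$ be their relative entropy, with the convention $0\log 0=0$ (the product $P(\log P-\log Q)$ is taken to be $0$ on $\ker P$). Then relative entropy does not increase under the following maps. (a) Let $\Phi^{\mathrm{QC}}$ be the map that projects a $d\times d$ matrix onto its diagonal, i.e. replaces all off-diagonal entries by $0$. If $\rho,\gamma$ are positive semi-definite $d\times d$ matrices with $\ker\gamma\subseteq\ker\rho$, then $$H[\Phi^{\mathrm{QC}}(\rho),\Phi^{\mathrm{QC}}(\gamma)]\le H(\rho,\gamma).$$ (b) If $\rho_{AB},\gamma_{AB}$ are positive semi-definite operators on a tensor product $\mathcal H_A\otimes\mathcal H_B$ of finite-dimensional Hilbert spaces with $\ker\gamma_{AB}\subseteq\ker\rho_{AB}$, and $\rho_A=\operatorname{Tr}_B\rho_{AB}$, $\rho_B=\operatorname{Tr}_A\rho_{AB}$ denote the partial traces (similarly $\gamma_A,\gamma_B$), then $$H(\rho_A,\gamma_A)\le H(\rho_{AB},\gamma_{AB})\quad\text{and}\quad H(\rho_B,\gamma_B)\le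 H(\rho_{AB},\gamma_{AB}).$$ (c) If $\Phi:M_d\to M_{d'}$ is any completely positive, trace-preserving linear map between complex matrix algebras and $\rho,\gamma\in M_d$ are positive semi-definite with $\ker\gamma\subseteq\ker\rho$, then $$H[\Phi(\rho),\Phi(\gamma)]\le H(\rho,\gamma).$$ In each case the pair of matrices on the left-hand side is again positive semi-definite and satisfies the kernel condition, so that the left-hand side is defined. -/

import Mathlib

open scoped ComplexOrder MatrixOrder

/-- The pairs `(P, Q)` of complex matrices for which the relative entropy is defined:
both are positive semi-definite and `ker Q ⊆ ker P`. -/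
structure RelEntropyDefined {n : Type*} [Fintype n] (P Q : Matrix n n ℂ) : Prop where
  posSemidef_left : P.PosSemidef
  posSemidef_right : Q.PosSemidef
  ker_le : LinearMap.ker Q.mulVecLin ≤ LinearMap.ker P.mulVecLin

/-- Relative entropy `H(P, Q) = Tr P (log P - log Q)`, for pairs with `RelEntropyDefined P Q`.
The logarithms are taken by functional calculus on the spectral decomposition. Since
`Real.log 0 = 0`, only the non-zero eigenvalues of `P` and of `Q` contribute; as `P` vanishes on
`ker Q`, this is the usual convention `0 log 0 = 0`. The trace is a real number. -/
noncomputable def relEntropy {n : Type*} [Fintype n] [DecidableEq n] (P Q : Matrix n n ℂ) : ℝ :=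
  (P * (cfc Real.log P - cfc Real.log Q)).trace.re

/-- The map `Φ^QC` that projects a matrix onto its diagonal. -/
def diagProj {n : Type*} [DecidableEq n] (X : Matrix n n ℂ) : Matrix n n ℂ :=
  Matrix.diagonal X.diag

/-- The partial trace over the second tensor factor: `X_A = Tr_B X`. -/
def partialTraceB {a b : Type*} [Fintype b] (X : Matrix (a × b) (a × b) ℂ) : Matrix a a ℂ :=
  Matrix.of fun i j => ∑ k, X (i, k) (j, k)

/-- The partial trace over the first tensor factor: `X_B = Tr_A X`. -/
def partialTraceA {a b : Type*} [Fintype a] (X : Matrix (a × b) (a × b) ℂ) : Matrix b b ℂ :=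
  Matrix.of fun i j => ∑ k, X (k, i) (k, j)

-- Complex matrices as a C*-algebra, and the notation `→CP` for completely positive maps.
open scoped Matrix.Norms.L2Operator CStarAlgebra

/-!
The relative entropy has the integral representation
`H(P, Q) = Tr P - Tr Q + ∫₀^∞ D_t(P, Q) (1 + t)⁻² dt`, where
`D_t(P, Q) = ∑ᵢⱼ |⟨vⱼ, uᵢ⟩|² (pᵢ - qⱼ)² / (qⱼ + t pᵢ)` in terms of the spectral decompositions
`P = ∑ pᵢ |uᵢ⟩⟨uᵢ|` and `Q = ∑ qⱼ |vⱼ⟩⟨vⱼ|` (`RelEntropyDefined.integral_representation`); this is a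
scalar identity for `p (log p - log q)` (`integral_sq_sub_div`), applied to each pair of
eigenvectors.

Completing squares in the eigenbases, `D_t(P, Q)` is the maximum over all matrices `X` of
`2 Re Tr Xᴴ(P - Q) - Tr XᴴQX - t Tr XPXᴴ` (`Matrix.PosSemidef.isGreatest_quadGain`). In this form it
is monotone under a trace-preserving `Φ`: if `Y` is the maximizer for `(Φ(P), Φ(Q))` and
`X = Φ*(Y)` for the Hilbert-Schmidt adjoint `Φ*`, the linear terms agree and the quadratic terms
satisfy `Tr XᴴQX ≤ Tr YᴴΦ(Q)Y` and `Tr XPXᴴ ≤ Tr YΦ(P)Yᴴ` (`IsTwoPositive.trace_adjoint_le`).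
These inequalities need only that `Φ` is 2-positive: they come from compressing the positive block
matrix `[[Φ(Q), Φ(QX)], [Φ(XᴴQ), Φ(XᴴQX)]]` by the column `(Y, -1)`. The same compression gives
`ker Φ(Q) ⊆ ker Φ(P)`, since `ker Q ⊆ ker P` means that `P = QZ` for some `Z`.

A completely positive map is 2-positive by definition, and the diagonal projection and the partial
traces are 2-positive because they have Kraus form.
-/

section

open Matrix

/-- A linear map between matrix algebras that is 2-positive. Every positive 2 × 2 block matrix is a
sum of matrices with blocks `AᴴA, AᴴB, BᴴA, BᴴB`, so it is enough to test on these. -/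
def IsTwoPositive {m n : Type*} [Fintype m] [Fintype n]
    (Φ : Matrix m m ℂ →ₗ[ℂ] Matrix n n ℂ) : Prop :=
  ∀ A B : Matrix m m ℂ,
    (fromBlocks (Φ (Aᴴ * A)) (Φ (Aᴴ * B)) (Φ (Bᴴ * A)) (Φ (Bᴴ * B))).PosSemidef

/-- Stated for an abstract C⋆-algebra, since instance search does not find the functional calculus
on `CStarMatrix` over a matrix algebra. -/
theorem exists_eq_star_mul_self_of_nonneg {A : Type*} [NonUnitalCStarAlgebra A] [PartialOrder A]
    [StarOrderedRing A] {a : A} (ha : 0 ≤ a) : ∃ b, a = star b * b :=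
  CStarAlgebra.nonneg_iff_eq_star_mul_self.mp ha

theorem Matrix.PosSemidef.exists_eq_conjTranspose_mul_self {n : Type*} [Fintype n]
    {Q : Matrix n n ℂ} (hQ : Q.PosSemidef) : ∃ R : Matrix n n ℂ, Q = Rᴴ * R := by
  classical
  exact exists_eq_star_mul_self_of_nonneg hQ.nonneg

/-! ### Two-positive trace-preserving maps -/

section Maps

variable {m n : Type*} [Fintype m] [Fintype n]

theorem isTwoPositive_of_kraus {ι : Type*} [Fintype ι] (K : ι → Matrix n m ℂ)
    (Φ : Matrix m m ℂ →ₗ[ℂ] Matrix n n ℂ) (hΦ : ∀ X, Φ X = ∑ k, K k * X * (K k)ᴴ) :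
    IsTwoPositive Φ := by
  intro A B
  have key : fromBlocks (Φ (Aᴴ * A)) (Φ (Aᴴ * B)) (Φ (Bᴴ * A)) (Φ (Bᴴ * B)) =
      ∑ k, (fromCols (A * (K k)ᴴ) (B * (K k)ᴴ))ᴴ * fromCols (A * (K k)ᴴ) (B * (K k)ᴴ) := by
    simp only [conjTranspose_fromCols_eq_fromRows_conjTranspose, fromRows_mul_fromCols, hΦ]
    ext (i | i) (j | j) <;> simp [Matrix.sum_apply, Matrix.mul_assoc]
  rw [key]
  exact posSemidef_sum _ fun k _ => posSemidef_conjTranspose_mul_self _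

/-- The block matrix with blocks `AᴴA, AᴴB, BᴴA, BᴴB` is `NᴴN` for `N` with rows `(A, B)` and `0`,
so only positivity of `Φ ⊗ id` on `2 × 2` matrices is used. -/
theorem isTwoPositive_of_completelyPositive [DecidableEq m] [DecidableEq n]
    (Φ : Matrix m m ℂ →CP Matrix n n ℂ) :
    IsTwoPositive (Φ : Matrix m m ℂ →ₗ[ℂ] Matrix n n ℂ) := by
  intro A B
  let N : CStarMatrix (Fin 2) (Fin 2) (Matrix m m ℂ) := CStarMatrix.ofMatrix !![A, B; 0, 0]
  have hN : 0 ≤ (star N * N).map Φ :=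
    CompletelyPositiveMapClass.map_cstarMatrix_nonneg' Φ 2 _ (star_mul_self_nonneg N)
  obtain ⟨L, hL⟩ := exists_eq_star_mul_self_of_nonneg hN
  have entry (i j : Fin 2) :
      Φ ((N 0 i)ᴴ * N 0 j + (N 1 i)ᴴ * N 1 j) = (L 0 i)ᴴ * L 0 j + (L 1 i)ᴴ * L 1 j := by
    have := congrFun (congrFun hL i) j
    simpa [CStarMatrix.mul_apply, CStarMatrix.star_apply, Fin.sum_univ_two,
      star_eq_conjTranspose] using this
  have key : fromBlocks (Φ (Aᴴ * A)) (Φ (Aᴴ * B)) (Φ (Bᴴ * A)) (Φ (Bᴴ * B)) =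
      (fromBlocks (L 0 0) (L 0 1) (L 1 0) (L 1 1))ᴴ *
        fromBlocks (L 0 0) (L 0 1) (L 1 0) (L 1 1) := by
    rw [fromBlocks_conjTranspose, fromBlocks_multiply, ← entry, ← entry, ← entry, ← entry]
    simp [N]
  change (fromBlocks (Φ (Aᴴ * A)) (Φ (Aᴴ * B)) (Φ (Bᴴ * A)) (Φ (Bᴴ * B))).PosSemidef
  rw [key]
  exact posSemidef_conjTranspose_mul_self _

/-- The image `X` of `Y` under the adjoint of `Φ` for the Hilbert-Schmidt inner
product. -/
theorem Matrix.exists_trace_adjoint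
    (Φ : Matrix m m ℂ →ₗ[ℂ] Matrix n n ℂ) (Y : Matrix n n ℂ) :
    ∃ X : Matrix m m ℂ, ∀ Z, (Yᴴ * Φ Z).trace = (Xᴴ * Z).trace := by
  classical
  refine ⟨(of fun i j => (Yᴴ * Φ (single j i 1)).trace)ᴴ, fun Z => ?_⟩
  conv_lhs => rw [matrix_eq_sum_single Z]
  have hs (i j : m) : single i j (Z i j) = Z i j • single i j (1 : ℂ) := by simp [smul_single]
  simp_rw [hs, map_sum, map_smul, Matrix.mul_sum, trace_sum, Matrix.mul_smul, trace_smul,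
    conjTranspose_conjTranspose]
  rw [Finset.sum_comm]
  simp [trace, Matrix.mul_apply, mul_comm]

namespace IsTwoPositive

variable {Φ : Matrix m m ℂ →ₗ[ℂ] Matrix n n ℂ}

theorem map_posSemidef (hΦ : IsTwoPositive Φ) {Q : Matrix m m ℂ} (hQ : Q.PosSemidef) :
    (Φ Q).PosSemidef := by
  classical
  obtain ⟨R, rfl⟩ := hQ.exists_eq_conjTranspose_mul_self
  exact (hΦ R 0).submatrix Sum.inl

theorem map_conjTranspose (hΦ : IsTwoPositive Φ) (X : Matrix m m ℂ) : Φ Xᴴ = (Φ X)ᴴ := by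
  classical
  have h := (hΦ 1 X).isHermitian
  rw [IsHermitian, fromBlocks_conjTranspose, fromBlocks_inj] at h
  simpa using h.2.2.1.symm

/-- Compression of the block inequality for `A = √Q`, `B = √Q X` by the column `(Y, -1)`. For `X`
the image of `Y` under the adjoint of `Φ` it becomes the Schwarz inequality of that adjoint. -/
theorem trace_schwarz (hΦ : IsTwoPositive Φ) (htr : ∀ X, (Φ X).trace = X.trace)
    {Q : Matrix m m ℂ} (hQ : Q.PosSemidef) (X : Matrix m m ℂ) (Y : Matrix n n ℂ) :
    0 ≤ (Yᴴ * Φ Q * Y).trace.re - 2 * (Yᴴ * Φ (Q * X)).trace.re + (Xᴴ * Q * X).trace.re := by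
  classical
  have hstar : (Φ (Xᴴ * Q) * Y).trace.re = (Yᴴ * Φ (Q * X)).trace.re := by
    have h : (Φ (Xᴴ * Q) * Y) = (Yᴴ * Φ (Q * X))ᴴ := by
      rw [conjTranspose_mul, conjTranspose_conjTranspose, ← hΦ.map_conjTranspose,
        conjTranspose_mul, hQ.isHermitian.eq]
    rw [h, trace_conjTranspose]
    simp
  obtain ⟨R, rfl⟩ := hQ.exists_eq_conjTranspose_mul_self
  have h := ((hΦ R (R * X)).conjTranspose_mul_mul_same (fromRows Y (-1))).trace_nonneg
  rw [conjTranspose_fromRows_eq_fromCols_conjTranspose, fromCols_mul_fromBlocks,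
    fromCols_mul_fromRows, conjTranspose_mul] at h
  have h2 := (Complex.le_def.mp h).1
  simp only [Matrix.mul_assoc, Matrix.add_mul, conjTranspose_neg, conjTranspose_one, neg_mul,
    one_mul, mul_neg, mul_one, trace_add, trace_neg, htr, Complex.add_re, Complex.neg_re,
    Complex.zero_re] at h2 hstar ⊢
  linarith

/-- If `X` is the image of `Y` under the adjoint of `Φ`, then `Tr XᴴQX ≤ Tr YᴴΦ(Q)Y`. -/
theorem trace_adjoint_le (hΦ : IsTwoPositive Φ) (htr : ∀ X, (Φ X).trace = X.trace)
    {Q : Matrix m m ℂ} (hQ : Q.PosSemidef) {X : Matrix m m ℂ} {Y : Matrix n n ℂ}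
    (hXY : ∀ Z, (Yᴴ * Φ Z).trace = (Xᴴ * Z).trace) :
    (Xᴴ * Q * X).trace.re ≤ (Yᴴ * Φ Q * Y).trace.re := by
  have h := hΦ.trace_schwarz htr hQ X Y
  rw [hXY, ← Matrix.mul_assoc] at h
  linarith

theorem adjoint_conjTranspose (hΦ : IsTwoPositive Φ) {X : Matrix m m ℂ} {Y : Matrix n n ℂ}
    (hXY : ∀ Z, (Yᴴ * Φ Z).trace = (Xᴴ * Z).trace) (Z : Matrix m m ℂ) :
    (Yᴴᴴ * Φ Z).trace = (Xᴴᴴ * Z).trace := by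
  have h := congrArg star (hXY Zᴴ)
  rw [← trace_conjTranspose, ← trace_conjTranspose, conjTranspose_mul, conjTranspose_mul,
    hΦ.map_conjTranspose, trace_mul_comm, trace_mul_comm Zᴴᴴ] at h
  simpa only [conjTranspose_conjTranspose] using h

end IsTwoPositive

/-- A factorization `P = Q * Z` is a form of `ker Q ⊆ ker P` that can be used inside `Φ`. -/
theorem RelEntropyDefined.exists_eq_mul {P Q : Matrix m m ℂ}
    (h : RelEntropyDefined P Q) : ∃ Z, P = Q * Z := by
  classical
  obtain ⟨g, hg⟩ : ∃ g : (m → ℂ) →ₗ[ℂ] (m → ℂ), P.mulVecLin = g ∘ₗ Q.mulVecLin := by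
    obtain ⟨g, hg⟩ := LinearMap.exists_extend
      ((Q.mulVecLin.ker.liftQ P.mulVecLin h.ker_le) ∘ₗ
        Q.mulVecLin.quotKerEquivRange.symm.toLinearMap)
    refine ⟨g, LinearMap.ext fun x => ?_⟩
    have hx := LinearMap.congr_fun hg ⟨Q.mulVecLin x, x, rfl⟩
    have hq : Q.mulVecLin.quotKerEquivRange.symm ⟨Q.mulVecLin x, x, rfl⟩ =
        Submodule.Quotient.mk x := by
      rw [LinearEquiv.symm_apply_eq]
      rfl
    simp only [LinearMap.comp_apply, LinearEquiv.coe_coe, hq, Submodule.subtype_apply] at hx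
    exact hx.symm
  refine ⟨(LinearMap.toMatrix' g)ᴴ, ?_⟩
  have hP : P = LinearMap.toMatrix' g * Q := by
    have := congrArg LinearMap.toMatrix' hg
    rwa [LinearMap.toMatrix'_comp, ← toLin'_apply', ← toLin'_apply', LinearMap.toMatrix'_toLin',
      LinearMap.toMatrix'_toLin'] at this
  have := congrArg conjTranspose hP
  rwa [conjTranspose_mul, h.posSemidef_left.isHermitian.eq,
    h.posSemidef_right.isHermitian.eq] at this

/-- For `P = QZ` and `Φ(Q)v = 0`, the trace inequality with `Y = |v⟩⟨Φ(P)v|` and `X` a real multiple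
of `Z` forces `‖Φ(P)v‖² = 0`. -/
theorem IsTwoPositive.relEntropyDefined {Φ : Matrix m m ℂ →ₗ[ℂ] Matrix n n ℂ}
    (hΦ : IsTwoPositive Φ) (htr : ∀ X, (Φ X).trace = X.trace) {P Q : Matrix m m ℂ}
    (h : RelEntropyDefined P Q) : RelEntropyDefined (Φ P) (Φ Q) := by
  refine ⟨hΦ.map_posSemidef h.posSemidef_left, hΦ.map_posSemidef h.posSemidef_right, ?_⟩
  intro v hv
  rw [LinearMap.mem_ker, mulVecLin_apply] at hv ⊢
  obtain ⟨Z, hZ⟩ := h.exists_eq_mul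
  set Y := vecMulVec v (star (Φ P *ᵥ v)) with hY
  have hQY : Φ Q * Y = 0 := by rw [hY, mul_vecMulVec, hv, zero_vecMulVec]
  -- The inequality holds for all real multiples of `Z` and its first term vanishes, so the
  -- linear term vanishes too.
  have hlin (s : ℝ) : 0 ≤ -2 * s * (Yᴴ * Φ P).trace.re + s ^ 2 * (Zᴴ * Q * Z).trace.re := by
    have := hΦ.trace_schwarz htr h.posSemidef_right ((s : ℂ) • Z) Y
    rw [Matrix.mul_assoc, hQY, Matrix.mul_smul, ← hZ, map_smul] at this
    simp at this
    nlinarith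
  have hzero : (Yᴴ * Φ P).trace.re = 0 := by
    set c := (Yᴴ * Φ P).trace.re
    set d := (Zᴴ * Q * Z).trace.re
    -- The multiple `s = c / (d + 1)` makes the right-hand side negative unless `c = 0`.
    have h0 : 0 ≤ d := by nlinarith [hlin 1, hlin (-1)]
    have h1 := hlin (c / (d + 1))
    have h2 : -2 * (c / (d + 1)) * c + (c / (d + 1)) ^ 2 * d =
        -(c ^ 2 * (d + 2) / (d + 1) ^ 2) := by field_simp; ring
    rw [h2] at h1
    by_contra hc
    have : 0 < c ^ 2 * (d + 2) / (d + 1) ^ 2 := by positivity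
    linarith
  have hP := (hΦ.map_posSemidef h.posSemidef_left).isHermitian
  have hval : (Yᴴ * Φ P).trace = star (Φ P *ᵥ v) ⬝ᵥ (Φ P *ᵥ v) := by
    rw [hY, conjTranspose_vecMulVec, star_star, vecMulVec_mul, trace_vecMulVec, dotProduct_comm,
      star_mulVec, hP.eq]
  rw [← dotProduct_star_self_eq_zero, ← hval]
  refine Complex.ext hzero ?_
  rw [hval]
  exact (Complex.le_def.mp (dotProduct_star_self_nonneg (Φ P *ᵥ v))).2.symm

/-- The functional of `X` whose maximum is `quadDivergence P Q t`. The last term `Tr X P Xᴴ` is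
written with `Xᴴᴴ` to be the second term with `P` and `Xᴴ` in place of `Q` and `X`. -/
noncomputable def quadGain (P Q : Matrix m m ℂ) (t : ℝ) (X : Matrix m m ℂ) : ℝ :=
  2 * (Xᴴ * (P - Q)).trace.re - (Xᴴ * Q * X).trace.re - t * (Xᴴᴴ * P * Xᴴ).trace.re

/-- The matrix `X` is the image of `Y` under the adjoint of `Φ`. -/
theorem IsTwoPositive.exists_quadGain_le {Φ : Matrix m m ℂ →ₗ[ℂ] Matrix n n ℂ}
    (hΦ : IsTwoPositive Φ) (htr : ∀ X, (Φ X).trace = X.trace) {P Q : Matrix m m ℂ}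
    (hP : P.PosSemidef) (hQ : Q.PosSemidef) {t : ℝ} (ht : 0 ≤ t) (Y : Matrix n n ℂ) :
    ∃ X, quadGain (Φ P) (Φ Q) t Y ≤ quadGain P Q t X := by
  obtain ⟨X, hX⟩ := exists_trace_adjoint Φ Y
  refine ⟨X, ?_⟩
  have h1 := hΦ.trace_adjoint_le htr hQ hX
  have h2 := mul_le_mul_of_nonneg_left
    (hΦ.trace_adjoint_le htr hP (hΦ.adjoint_conjTranspose hX)) ht
  rw [quadGain, quadGain, ← map_sub, hX]
  linarith

end Maps

/-! ### The scalar integral -/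

open MeasureTheory Set Filter Topology in
/-- The scalar identity behind the integral representation of the relative entropy. -/
theorem integral_sq_sub_div {p q : ℝ} (hp : 0 ≤ p) (hq : 0 < q) :
    IntegrableOn (fun t => (p - q) ^ 2 / (q + t * p) / (1 + t) ^ 2) (Ioi 0) ∧
      ∫ t in Ioi 0, (p - q) ^ 2 / (q + t * p) / (1 + t) ^ 2 =
        p * (Real.log p - Real.log q) - (p - q) := by
  -- An antiderivative, found by partial fractions; `F 0 = p log q + p - q`.
  let F : ℝ → ℝ := fun t =>
    p * (Real.log (q + t * p) - Real.log (1 + t)) + (p - q) / (1 + t)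
  have hd : ∀ t ∈ Ici (0 : ℝ), HasDerivAt F ((p - q) ^ 2 / (q + t * p) / (1 + t) ^ 2) t := by
    intro t ht
    have ht0 : 0 ≤ t := ht
    have h1 : 0 < q + t * p := by positivity
    have h2 : 0 < 1 + t := by positivity
    have hA : HasDerivAt (fun t : ℝ => q + t * p) (1 * p) t :=
      ((hasDerivAt_id t).mul_const p).const_add q
    have hB : HasDerivAt (fun t : ℝ => 1 + t) 1 t := (hasDerivAt_id t).const_add 1
    have := (((hA.log h1.ne').sub (hB.log h2.ne')).const_mul p).add
      ((hasDerivAt_const t (p - q)).div hB h2.ne')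
    refine this.congr_deriv ?_
    field_simp
    ring
  have hpos : ∀ t ∈ Ioi (0 : ℝ), 0 ≤ (p - q) ^ 2 / (q + t * p) / (1 + t) ^ 2 := by
    intro t ht
    have ht0 : 0 < t := ht
    positivity
  have hinv : Tendsto (fun t : ℝ => (p - q) / (1 + t)) atTop (𝓝 0) :=
    tendsto_const_nhds.div_atTop (tendsto_atTop_add_const_left _ _ tendsto_id)
  have hlim : Tendsto F atTop (𝓝 (p * Real.log p)) := by
    rcases hp.eq_or_lt with rfl | hp
    · simpa [F] using hinv
    · have h1 : Tendsto (fun t : ℝ => p + (q - p) / (1 + t)) atTop (𝓝 (p + 0)) := by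
        refine tendsto_const_nhds.add ?_
        exact tendsto_const_nhds.div_atTop (tendsto_atTop_add_const_left _ _ tendsto_id)
      rw [add_zero] at h1
      have h2 := ((h1.log hp.ne').const_mul p).add hinv
      rw [add_zero] at h2
      refine h2.congr' ?_
      filter_upwards [eventually_ge_atTop 0] with t ht
      have h3 : 0 < 1 + t := by positivity
      have h4 : 0 < q + t * p := by positivity
      have h5 : p + (q - p) / (1 + t) = (q + t * p) / (1 + t) := by field_simp; ring
      simp only [F]
      rw [h5, Real.log_div h4.ne' h3.ne']
  refine ⟨integrableOn_Ioi_deriv_of_nonneg' hd hpos hlim, ?_⟩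
  rw [integral_Ioi_of_hasDerivAt_of_nonneg' hd hpos hlim]
  simp [F]
  ring

/-! ### Traces and the quadratic functional in eigenbases -/

section Eigenbases

variable {m : Type*} [Fintype m] [DecidableEq m]

/-- The columns `uᵢ` of `U` and `vⱼ` of `V` are eigenvectors of the two factors, which need not
commute; the weights are the squared overlaps `|⟨vⱼ, uᵢ⟩|²`. -/
theorem re_trace_mul_of_diagonal (U V : Matrix m m ℂ) (f g : m → ℝ) :
    ((U * diagonal (fun i => (f i : ℂ)) * Uᴴ) * (V * diagonal (fun j => (g j : ℂ)) * Vᴴ)).trace.re =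
      ∑ j, ∑ i, ‖(Vᴴ * U) j i‖ ^ 2 * (f i * g j) := by
  have h : ((U * diagonal (fun i => (f i : ℂ)) * Uᴴ) *
      (V * diagonal (fun j => (g j : ℂ)) * Vᴴ)).trace =
      ((Vᴴ * U) * diagonal (fun i => (f i : ℂ)) * (Vᴴ * U)ᴴ *
        diagonal (fun j => (g j : ℂ))).trace := by
    rw [← Matrix.mul_assoc, trace_mul_comm, conjTranspose_mul, conjTranspose_conjTranspose]
    simp only [Matrix.mul_assoc]
  rw [h]
  simp only [trace, diag_apply, mul_diagonal, Matrix.mul_apply (M := _ * diagonal _),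
    conjTranspose_apply, Complex.re_sum, Finset.sum_mul]
  refine Finset.sum_congr rfl fun j _ => Finset.sum_congr rfl fun i _ => ?_
  have : (Vᴴ * U) j i * (f i : ℂ) * star ((Vᴴ * U) j i) * (g j : ℂ) =
      ((‖(Vᴴ * U) j i‖ ^ 2 * (f i * g j) : ℝ) : ℂ) := by
    push_cast
    rw [← Complex.mul_conj']
    simp only [Complex.star_def]
    ring
  rw [this, Complex.ofReal_re]

/-- With `x` the matrix of `X` in the two eigenbases, the functional decouples into scalar quadratic
functions of the entries of `x`. -/
theorem quadGain_of_diagonal {U V : Matrix m m ℂ} (hU : Uᴴ * U = 1) (hV : Vᴴ * V = 1)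
    (p q : m → ℝ) (t : ℝ) (x : Matrix m m ℂ) :
    quadGain (U * diagonal (fun i => (p i : ℂ)) * Uᴴ) (V * diagonal (fun j => (q j : ℂ)) * Vᴴ) t
      (V * x * Uᴴ) = ∑ j, ∑ i, (2 * (p i - q j) * (star (x j i) * (Vᴴ * U) j i).re -
        (q j + t * p i) * ‖x j i‖ ^ 2) := by
  set p' := diagonal (fun i => (p i : ℂ)) with hp'
  set q' := diagonal (fun i => (q i : ℂ)) with hq'
  have hU' (Z : Matrix m m ℂ) : Uᴴ * (U * Z) = Z := by rw [← Matrix.mul_assoc, hU, Matrix.one_mul]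
  have hV' (Z : Matrix m m ℂ) : Vᴴ * (V * Z) = Z := by rw [← Matrix.mul_assoc, hV, Matrix.one_mul]
  have h1 : ((V * x * Uᴴ)ᴴ * (U * p' * Uᴴ - V * q' * Vᴴ)).trace =
      (xᴴ * ((Vᴴ * U) * p' - q' * (Vᴴ * U))).trace := by
    simp only [conjTranspose_mul, conjTranspose_conjTranspose, Matrix.mul_sub, trace_sub,
      Matrix.mul_assoc, hV']
    rw [trace_mul_comm, trace_mul_comm U]
    simp only [Matrix.mul_assoc, hU, Matrix.mul_one]
  have h2 : ((V * x * Uᴴ)ᴴ * (V * q' * Vᴴ) * (V * x * Uᴴ)).trace = (xᴴ * q' * x).trace := by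
    simp only [conjTranspose_mul, conjTranspose_conjTranspose, Matrix.mul_assoc, hV']
    rw [trace_mul_comm]
    simp only [Matrix.mul_assoc, hU, Matrix.mul_one]
  have h3 : ((V * x * Uᴴ)ᴴᴴ * (U * p' * Uᴴ) * (V * x * Uᴴ)ᴴ).trace = (x * p' * xᴴ).trace := by
    simp only [conjTranspose_mul, conjTranspose_conjTranspose, Matrix.mul_assoc, hU']
    rw [trace_mul_comm]
    simp only [Matrix.mul_assoc, hV, Matrix.mul_one]
  rw [quadGain, h1, h2, h3]
  have e1 : (xᴴ * ((Vᴴ * U) * p' - q' * (Vᴴ * U))).trace.re =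
      ∑ j, ∑ i, (p i - q j) * (star (x j i) * (Vᴴ * U) j i).re := by
    rw [Finset.sum_comm]
    simp only [trace, diag_apply, Matrix.mul_apply (M := xᴴ), Matrix.sub_apply, hp', hq',
      mul_diagonal, diagonal_mul, conjTranspose_apply, Complex.re_sum]
    refine Finset.sum_congr rfl fun j _ => Finset.sum_congr rfl fun i _ => ?_
    rw [← Complex.re_ofReal_mul]
    congr 1
    push_cast
    ring
  have e2 : (xᴴ * q' * x).trace.re = ∑ j, ∑ i, q j * ‖x j i‖ ^ 2 := by
    rw [Finset.sum_comm]
    simp only [trace, diag_apply, Matrix.mul_apply (M := _ * diagonal _), hq',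
      mul_diagonal, conjTranspose_apply, Complex.re_sum]
    refine Finset.sum_congr rfl fun j _ => Finset.sum_congr rfl fun i _ => ?_
    rw [← Complex.ofReal_re (q i * _)]
    congr 1
    push_cast
    rw [← Complex.conj_mul', Complex.star_def]
    ring
  have e3 : (x * p' * xᴴ).trace.re = ∑ j, ∑ i, p i * ‖x j i‖ ^ 2 := by
    simp only [trace, diag_apply, Matrix.mul_apply (M := _ * diagonal _), hp',
      mul_diagonal, conjTranspose_apply, Complex.re_sum]
    refine Finset.sum_congr rfl fun j _ => Finset.sum_congr rfl fun i _ => ?_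
    rw [← Complex.ofReal_re (p i * _)]
    congr 1
    push_cast
    rw [← Complex.conj_mul', Complex.star_def]
    ring
  rw [e1, e2, e3]
  simp only [Finset.mul_sum, ← Finset.sum_sub_distrib]
  refine Finset.sum_congr rfl fun j _ => Finset.sum_congr rfl fun i _ => ?_
  ring

/-- Completing the square in each entry `x j i`; the maximum is attained at
`x j i = (p i - q j) / (q j + t * p i) * (Vᴴ * U) j i`. -/
theorem isGreatest_quadGain_of_diagonal {U V : Matrix m m ℂ} (hU : Uᴴ * U = 1) (hV : Vᴴ * V = 1)
    {p q : m → ℝ} (hp : ∀ i, 0 ≤ p i) (hq : ∀ j, 0 ≤ q j) {t : ℝ} (ht : 0 < t) :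
    IsGreatest (Set.range (quadGain (U * diagonal (fun i => (p i : ℂ)) * Uᴴ)
      (V * diagonal (fun j => (q j : ℂ)) * Vᴴ) t))
      (∑ j, ∑ i, ‖(Vᴴ * U) j i‖ ^ 2 * ((p i - q j) ^ 2 / (q j + t * p i))) := by
  -- A zero denominator forces `p i = q j = 0`, so the numerator vanishes too.
  have hden (i j : m) : (p i = 0 ∧ q j = 0) ∨ 0 < q j + t * p i := by
    rcases (hp i).eq_or_lt with h | h
    · rcases (hq j).eq_or_lt with h' | h'
      · exact .inl ⟨h.symm, h'.symm⟩
      · right; rw [← h]; linarith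
    · right; have := hq j; positivity
  constructor
  · refine ⟨V * (of fun j i => (((p i - q j) / (q j + t * p i) : ℝ) : ℂ) * (Vᴴ * U) j i) * Uᴴ, ?_⟩
    rw [quadGain_of_diagonal hU hV]
    refine Finset.sum_congr rfl fun j _ => Finset.sum_congr rfl fun i _ => ?_
    set w := (Vᴴ * U) j i
    have h1 : (star ((((p i - q j) / (q j + t * p i) : ℝ) : ℂ) * w) * w).re =
        (p i - q j) / (q j + t * p i) * ‖w‖ ^ 2 := by
      rw [← Complex.ofReal_re (_ * ‖w‖ ^ 2)]
      congr 1
      rw [Complex.ofReal_mul, Complex.ofReal_pow, ← Complex.conj_mul', Complex.star_def, map_mul,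
        Complex.conj_ofReal, mul_assoc]
    rw [of_apply, h1, norm_mul, mul_pow, Complex.norm_real, Real.norm_eq_abs, sq_abs]
    rcases hden i j with ⟨h, h'⟩ | h
    · simp [h, h']
    · field_simp
      ring
  · rintro _ ⟨X, rfl⟩
    have hX : X = V * (Vᴴ * X * U) * Uᴴ := by
      have hU' := mul_eq_one_comm.mp hU
      have hV' := mul_eq_one_comm.mp hV
      rw [← Matrix.mul_assoc, ← Matrix.mul_assoc, hV', Matrix.one_mul, Matrix.mul_assoc, hU',
        Matrix.mul_one]
    rw [hX, quadGain_of_diagonal hU hV]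
    refine Finset.sum_le_sum fun j _ => Finset.sum_le_sum fun i _ => ?_
    set w := (Vᴴ * U) j i
    set x := (Vᴴ * X * U) j i
    rcases hden i j with ⟨h, h'⟩ | h
    · simp [h, h']
    · set c := (p i - q j) / (q j + t * p i) with hc
      have hpq : p i - q j = c * (q j + t * p i) := by rw [hc, div_mul_cancel₀ _ h.ne']
      have h0 : 0 ≤ ‖x - c * w‖ ^ 2 := by positivity
      have h1 : ‖x - c * w‖ ^ 2 = ‖x‖ ^ 2 - 2 * c * (star x * w).re + c ^ 2 * ‖w‖ ^ 2 := by
        simp only [← Complex.normSq_eq_norm_sq, Complex.normSq_apply]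
        simp
        ring
      have h2 : (p i - q j) ^ 2 / (q j + t * p i) = c ^ 2 * (q j + t * p i) := by
        rw [hpq]; field_simp
      rw [h2, hpq]
      nlinarith [mul_nonneg h.le (h1 ▸ h0)]

end Eigenbases

/-! ### Integral representation and monotonicity -/

section Representation

open MeasureTheory Set

variable {m : Type*} [Fintype m]

/-- The quadratic divergence `∑ |⟨vⱼ, uᵢ⟩|² (pᵢ - qⱼ)² / (qⱼ + t pᵢ)` of `P = ∑ pᵢ |uᵢ⟩⟨uᵢ|` and
`Q = ∑ qⱼ |vⱼ⟩⟨vⱼ|`, in its variational form. For positive semi-definite matrices and `t > 0` the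
supremum is a maximum. -/
noncomputable def quadDivergence (P Q : Matrix m m ℂ) (t : ℝ) : ℝ :=
  ⨆ X, quadGain P Q t X

theorem Matrix.IsHermitian.exists_diagonalization [DecidableEq m] {P : Matrix m m ℂ}
    (hP : P.IsHermitian) : ∃ U : Matrix m m ℂ, Uᴴ * U = 1 ∧
      P = U * Matrix.diagonal (fun i => (hP.eigenvalues i : ℂ)) * Uᴴ ∧
      ∀ f : ℝ → ℝ, hP.cfc f = U * Matrix.diagonal (fun i => (f (hP.eigenvalues i) : ℂ)) * Uᴴ := by
  refine ⟨hP.eigenvectorUnitary, Unitary.coe_star_mul_self hP.eigenvectorUnitary, ?_, fun f => ?_⟩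
  · conv_lhs => rw [hP.spectral_theorem, Unitary.conjStarAlgAut_apply]
    rfl
  · rw [IsHermitian.cfc, Unitary.conjStarAlgAut_apply]
    rfl

theorem Matrix.PosSemidef.isGreatest_quadGain {P Q : Matrix m m ℂ}
    (hP : P.PosSemidef) (hQ : Q.PosSemidef) {t : ℝ} (ht : 0 < t) :
    IsGreatest (range (quadGain P Q t)) (quadDivergence P Q t) := by
  classical
  obtain ⟨U, hU, hPd, -⟩ := hP.isHermitian.exists_diagonalization
  obtain ⟨V, hV, hQd, -⟩ := hQ.isHermitian.exists_diagonalization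
  have h := isGreatest_quadGain_of_diagonal hU hV hP.eigenvalues_nonneg hQ.eigenvalues_nonneg ht
  rw [← hPd, ← hQd] at h
  rwa [quadDivergence, ← sSup_range, h.csSup_eq]

/-- The kernel condition says that no eigenvector of `P` with non-zero eigenvalue overlaps with an
eigenvector of `Q` with eigenvalue zero. -/
theorem RelEntropyDefined.overlap_eq_zero [DecidableEq m] {U V : Matrix m m ℂ} (hU : Uᴴ * U = 1)
    (hV : Vᴴ * V = 1) {p q : m → ℝ}
    (h : RelEntropyDefined (U * Matrix.diagonal (fun i => (p i : ℂ)) * Uᴴ)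
      (V * Matrix.diagonal (fun j => (q j : ℂ)) * Vᴴ)) {i j : m} (hq : q j = 0) (hp : p i ≠ 0) :
    (Vᴴ * U) j i = 0 := by
  obtain ⟨Z, hZ⟩ := h.exists_eq_mul
  have h1 : (Vᴴ * U) * Matrix.diagonal (fun i => (p i : ℂ)) =
      Matrix.diagonal (fun j => (q j : ℂ)) * (Vᴴ * Z * U) := by
    have h2 := congrArg (fun M => Vᴴ * M * U) hZ
    simp only [Matrix.mul_assoc, hU, Matrix.mul_one] at h2
    rw [← Matrix.mul_assoc Vᴴ V, hV, Matrix.one_mul] at h2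
    simpa only [Matrix.mul_assoc] using h2
  have h3 := congrFun (congrFun h1 j) i
  rw [mul_diagonal, diagonal_mul, hq, Complex.ofReal_zero, zero_mul] at h3
  exact (mul_eq_zero.mp h3).resolve_right (Complex.ofReal_ne_zero.mpr hp)

/-- The integral representation of the relative entropy, term by term over pairs of eigenvectors. A
pair with `q j = 0 < p i`, for which the scalar integral diverges, has overlap zero. -/
theorem RelEntropyDefined.integral_representation [DecidableEq m] {P Q : Matrix m m ℂ}
    (h : RelEntropyDefined P Q) :
    IntegrableOn (fun t => quadDivergence P Q t / (1 + t) ^ 2) (Ioi 0) ∧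
      relEntropy P Q = P.trace.re - Q.trace.re +
        ∫ t in Ioi 0, quadDivergence P Q t / (1 + t) ^ 2 := by
  have hP := h.posSemidef_left
  have hQ := h.posSemidef_right
  obtain ⟨U, hU, hPd, hUP⟩ := hP.isHermitian.exists_diagonalization
  obtain ⟨V, hV, hQd, hVQ⟩ := hQ.isHermitian.exists_diagonalization
  set p := hP.isHermitian.eigenvalues with hp
  set q := hQ.isHermitian.eigenvalues with hq
  have hp0 : ∀ i, 0 ≤ p i := hP.eigenvalues_nonneg
  have hq0 : ∀ i, 0 ≤ q i := hQ.eigenvalues_nonneg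
  have hU1 : U * Matrix.diagonal (fun _ : m => ((1 : ℝ) : ℂ)) * Uᴴ = 1 := by
    simpa using mul_eq_one_comm.mp hU
  have hV1 : V * Matrix.diagonal (fun _ : m => ((1 : ℝ) : ℂ)) * Vᴴ = 1 := by
    simpa using mul_eq_one_comm.mp hV
  -- All the traces are sums over pairs of eigenvectors, weighted by the overlaps.
  have trP := re_trace_mul_of_diagonal U V p (fun _ => 1)
  rw [← hPd, hV1, Matrix.mul_one] at trP
  have trQ := re_trace_mul_of_diagonal U V (fun _ => 1) q
  rw [← hQd, hU1, Matrix.one_mul] at trQ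
  have trPQ := re_trace_mul_of_diagonal U V p (fun j => Real.log (q j))
  rw [← hPd, ← hVQ] at trPQ
  have trPP := re_trace_mul_of_diagonal U V (fun i => p i * Real.log (p i)) (fun _ => 1)
  have hPlog : P * hP.isHermitian.cfc Real.log =
      U * Matrix.diagonal (fun i => ((p i * Real.log (p i) : ℝ) : ℂ)) * Uᴴ := by
    rw [hUP]
    conv_lhs => enter [1]; rw [hPd]
    rw [Matrix.mul_assoc (U * _), ← Matrix.mul_assoc Uᴴ, ← Matrix.mul_assoc Uᴴ, hU, Matrix.one_mul,
      ← Matrix.mul_assoc, Matrix.mul_assoc U, diagonal_mul_diagonal]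
    simp only [Complex.ofReal_mul]
  rw [hV1, Matrix.mul_one, ← hPlog] at trPP
  have hdiv : ∀ t ∈ Ioi (0 : ℝ), quadDivergence P Q t / (1 + t) ^ 2 =
      ∑ j, ∑ i, ‖(Vᴴ * U) j i‖ ^ 2 * ((p i - q j) ^ 2 / (q j + t * p i) / (1 + t) ^ 2) := by
    intro t ht
    have hg := isGreatest_quadGain_of_diagonal hU hV hp0 hq0 ht
    rw [← hPd, ← hQd] at hg
    rw [(hP.isGreatest_quadGain hQ ht).unique hg, Finset.sum_div]
    simp only [Finset.sum_div, mul_div_assoc]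
  have hscalar (j i : m) :
      IntegrableOn (fun t => ‖(Vᴴ * U) j i‖ ^ 2 *
        ((p i - q j) ^ 2 / (q j + t * p i) / (1 + t) ^ 2)) (Ioi 0) ∧
      ∫ t in Ioi 0, ‖(Vᴴ * U) j i‖ ^ 2 * ((p i - q j) ^ 2 / (q j + t * p i) / (1 + t) ^ 2) =
        ‖(Vᴴ * U) j i‖ ^ 2 * (p i * (Real.log (p i) - Real.log (q j)) - (p i - q j)) := by
    rcases (hq0 j).eq_or_lt with h0 | h0
    · by_cases hpi : p i = 0
      · simp [hpi, ← h0]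
      · rw [hPd, hQd] at h
        simp [h.overlap_eq_zero hU hV h0.symm hpi]
    · have hs := integral_sq_sub_div (hp0 i) h0
      exact ⟨hs.1.const_mul _, by rw [integral_const_mul, hs.2]⟩
  have hint : ∀ j ∈ Finset.univ, Integrable (fun t => ∑ i, ‖(Vᴴ * U) j i‖ ^ 2 *
      ((p i - q j) ^ 2 / (q j + t * p i) / (1 + t) ^ 2)) (volume.restrict (Ioi 0)) :=
    fun j _ => integrable_finsetSum _ fun i _ => (hscalar j i).1
  constructor
  · exact (integrableOn_congr_fun hdiv measurableSet_Ioi).mpr (integrable_finsetSum _ hint)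
  · rw [setIntegral_congr_fun measurableSet_Ioi hdiv, integral_finsetSum _ hint]
    simp_rw [fun j => integral_finsetSum Finset.univ fun i _ => (hscalar j i).1, (hscalar _ _).2]
    rw [relEntropy, hP.isHermitian.cfc_eq, hQ.isHermitian.cfc_eq, Matrix.mul_sub, trace_sub,
      Complex.sub_re, trPP, trPQ, trP, trQ]
    simp only [← Finset.sum_sub_distrib, ← Finset.sum_add_distrib]
    refine Finset.sum_congr rfl fun j _ => Finset.sum_congr rfl fun i _ => ?_
    ring

/-- Monotonicity of the relative entropy, by comparing the integrands for each `t`. -/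
theorem IsTwoPositive.relEntropy_le {n : Type*} [Fintype n] [DecidableEq m] [DecidableEq n]
    {Φ : Matrix m m ℂ →ₗ[ℂ] Matrix n n ℂ} (hΦ : IsTwoPositive Φ)
    (htr : ∀ X, (Φ X).trace = X.trace) {P Q : Matrix m m ℂ} (h : RelEntropyDefined P Q) :
    relEntropy (Φ P) (Φ Q) ≤ relEntropy P Q := by
  obtain ⟨hi, hrep⟩ := h.integral_representation
  obtain ⟨hi', hrep'⟩ := (hΦ.relEntropyDefined htr h).integral_representation
  rw [hrep, hrep', htr, htr]
  refine add_le_add_right (setIntegral_mono_on hi' hi measurableSet_Ioi fun t ht => ?_) _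
  have hP := h.posSemidef_left
  have hQ := h.posSemidef_right
  have hmax := hP.isGreatest_quadGain hQ ht
  obtain ⟨Y, hY⟩ :=
    ((hΦ.map_posSemidef hP).isGreatest_quadGain (hΦ.map_posSemidef hQ) ht).1
  obtain ⟨X, hX⟩ := hΦ.exists_quadGain_le htr hP hQ (le_of_lt ht) Y
  rw [← hY]
  exact div_le_div_of_nonneg_right (hX.trans (hmax.2 ⟨X, rfl⟩)) (by positivity)

end Representation

/-! ### Diagonal projection and partial traces in Kraus form -/

section Instances

/-- Trace-preserving maps in Kraus form do not increase the relative entropy. -/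
theorem relEntropy_le_of_kraus {m n ι : Type*} [Fintype m] [DecidableEq m] [Fintype n]
    [DecidableEq n] [Fintype ι] (K : ι → Matrix n m ℂ) (Ψ : Matrix m m ℂ → Matrix n n ℂ)
    (hΨ : ∀ X, Ψ X = ∑ k, K k * X * (K k)ᴴ) (htr : ∀ X, (Ψ X).trace = X.trace)
    {P Q : Matrix m m ℂ} (h : RelEntropyDefined P Q) :
    RelEntropyDefined (Ψ P) (Ψ Q) ∧ relEntropy (Ψ P) (Ψ Q) ≤ relEntropy P Q := by
  let Φ : Matrix m m ℂ →ₗ[ℂ] Matrix n n ℂ :=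
    { toFun := Ψ
      map_add' := fun X Y => by
        simp only [hΨ, Matrix.mul_add, Matrix.add_mul, Finset.sum_add_distrib]
      map_smul' := fun c X => by
        simp only [hΨ, Matrix.mul_smul, Matrix.smul_mul, Finset.smul_sum, RingHom.id_apply] }
  have hΦ : IsTwoPositive Φ := isTwoPositive_of_kraus K Φ hΨ
  exact ⟨hΦ.relEntropyDefined (Φ := Φ) htr h, hΦ.relEntropy_le (Φ := Φ) htr h⟩

variable {a b : Type*} [Fintype a] [Fintype b]

theorem diagProj_eq_kraus [DecidableEq a] (X : Matrix a a ℂ) :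
    diagProj X = ∑ k, single k k 1 * X * (single k k 1)ᴴ := by
  ext i j
  by_cases h : i = j
  · subst h; simp [diagProj, Matrix.sum_apply, single_apply]
  · have hX : ∑ c, (if c = i ∧ c = j then X c c else 0) = 0 :=
      Finset.sum_eq_zero fun c _ => if_neg fun hc => h (hc.1.symm.trans hc.2)
    simp [diagProj, Matrix.sum_apply, single_apply, h, hX]

theorem partialTraceB_eq_kraus [DecidableEq a] [DecidableEq b]
    (X : Matrix (a × b) (a × b) ℂ) :
    partialTraceB X = ∑ k, (of fun i x => if x = (i, k) then 1 else 0 : Matrix a (a × b) ℂ) * X *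
      (of fun i x => if x = (i, k) then 1 else 0 : Matrix a (a × b) ℂ)ᴴ := by
  ext i j
  simp [partialTraceB, Matrix.sum_apply, Matrix.mul_apply]

theorem partialTraceA_eq_kraus [DecidableEq a] [DecidableEq b]
    (X : Matrix (a × b) (a × b) ℂ) :
    partialTraceA X = ∑ k, (of fun i x => if x = (k, i) then 1 else 0 : Matrix b (a × b) ℂ) * X *
      (of fun i x => if x = (k, i) then 1 else 0 : Matrix b (a × b) ℂ)ᴴ := by
  ext i j
  simp [partialTraceA, Matrix.sum_apply, Matrix.mul_apply]

theorem trace_diagProj [DecidableEq a] (X : Matrix a a ℂ) : (diagProj X).trace = X.trace := by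
  simp [diagProj, trace]

theorem trace_partialTraceB (X : Matrix (a × b) (a × b) ℂ) :
    (partialTraceB X).trace = X.trace := by
  simp [partialTraceB, trace, Fintype.sum_prod_type]

theorem trace_partialTraceA (X : Matrix (a × b) (a × b) ℂ) :
    (partialTraceA X).trace = X.trace := by
  simp [partialTraceA, trace, Fintype.sum_prod_type_right]

end Instances

end

theorem theorem2 {a b : Type*} [Fintype a] [DecidableEq a] [Fintype b] [DecidableEq b] :
    -- (a) projection onto the diagonal
    (∀ ρ γ : Matrix a a ℂ, RelEntropyDefined ρ γ →
      RelEntropyDefined (diagProj ρ) (diagProj γ) ∧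
        relEntropy (diagProj ρ) (diagProj γ) ≤ relEntropy ρ γ) ∧
    -- (b) partial trace, over either factor
    (∀ ρ γ : Matrix (a × b) (a × b) ℂ, RelEntropyDefined ρ γ →
      (RelEntropyDefined (partialTraceB ρ) (partialTraceB γ) ∧
        relEntropy (partialTraceB ρ) (partialTraceB γ) ≤ relEntropy ρ γ) ∧
      (RelEntropyDefined (partialTraceA ρ) (partialTraceA γ) ∧
        relEntropy (partialTraceA ρ) (partialTraceA γ) ≤ relEntropy ρ γ)) ∧
    -- (c) completely positive trace-preserving maps
    (∀ Φ : Matrix a a ℂ →CP Matrix b b ℂ, (∀ X, (Φ X).trace = X.trace) →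
      ∀ ρ γ : Matrix a a ℂ, RelEntropyDefined ρ γ →
        RelEntropyDefined (Φ ρ) (Φ γ) ∧ relEntropy (Φ ρ) (Φ γ) ≤ relEntropy ρ γ) := by
  refine ⟨fun ρ γ h => ?_, fun ρ γ h => ⟨?_, ?_⟩, fun Φ htr ρ γ h => ?_⟩
  · exact relEntropy_le_of_kraus _ diagProj diagProj_eq_kraus trace_diagProj h
  · exact relEntropy_le_of_kraus _ partialTraceB partialTraceB_eq_kraus trace_partialTraceB h
  · exact relEntropy_le_of_kraus _ partialTraceA partialTraceA_eq_kraus trace_partialTraceA h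
  · have hΦ := isTwoPositive_of_completelyPositive Φ
    exact ⟨hΦ.relEntropyDefined htr h, hΦ.relEntropy_le htr h⟩
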